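/- Let $0<\rho<1$, $\lambda>0$, $\beta>0$, $c_0>0$. Let $K(j)=\mathcal C_K\,j^{-(1+\rho)}$, $j\ge 1$, with $\mathcal C_K$ such that $\sum_{j\ge1}K(j)=1$. For $L\in\mathbb N$ put $\ell=\ell(L)=\lfloor(\log L)^{1+\beta}\rfloor$ and $r=\lfloor L/\ell\rfloor-1$, and define $$\tilde K(x)=c_0\,\frac{\lambda}{\lambda+1/K((x+1)\ell)},\qquad x\ge 1 .$$ Let $(\tilde\zeta(k))_{k=0,1,2,\dots}$ be the Markov chain on $\{0,1\}^{\{0,1,2,\dots\}}$ with $\tilde\zeta_0(0)=1$ and $\tilde\zeta_j(0)=0$ for $j\ge1$, which evolves as follows. Site $0$ is always occupied, $\tilde\zeta_0(k)=1$. Given $\tilde\zeta(0),\dots,\tilde\zeta(k-1)$, let $(B_j(k))_{j\ge1}$ be independent Bernoulli variables with parameters $\tilde K(j-\tilde h_j(k-1))$, where $\tilde h_j(k-1)=\max\{n<j:\tilde\zeta_n(k-1)=1\}$ is the position of the rightmost particle to the left of $j$, and set $$\tilde\zeta_j(k)=\tilde\zeta_j(k-1)+(1-\tilde\zeta_j(k-1))\,B_j(k),\qquad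 j\ge1 .$$ (For $L$ large one has $\tilde K\le1$, so that these parameters are probabilities.) Then for every $\varepsilon>0$ there is a constant $c(\varepsilon)>0$, which may depend also on $\lambda$ but not on $\rho,\beta,c_0$ or $L$, such that, with $T(L)=L^{\rho}\,\ell^{\,2+\rho+\varepsilon}$, for all sufficiently large $L$ (how large may depend on all the parameters) $$\mathbb P\big(\forall j\in\{1,\dots,r\}:\ \tilde\zeta_j(\lfloor T(L)\rfloor)=1\big)\ \ge\ 1-e^{-c(\varepsilon)\,\ell}.$$ -/

import Mathlib

open MeasureTheory ProbabilityTheory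

namespace FrontProcess

/-- A configuration in `{0,1}^{0,1,2,…}`: `σ j = true` means that site `j` is occupied. -/
abbrev Config : Type := ℕ → Bool

/-- The probability law `K(j) = C_K j^{-(1+ρ)}` on the positive integers, where
`C_K = (∑_{i ≥ 1} i^{-(1+ρ)})⁻¹` is the normalizing constant. -/
noncomputable def K (ρ : ℝ) (j : ℕ) : ℝ :=
  (∑' i : ℕ, ((i : ℝ) + 1) ^ (-(1 + ρ)))⁻¹ * (j : ℝ) ^ (-(1 + ρ))

/-- The block length `ℓ(L) = ⌊(log L)^{1+β}⌋`. -/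
noncomputable def blockLength (β : ℝ) (L : ℕ) : ℕ :=
  ⌊(Real.log (L : ℝ)) ^ (1 + β)⌋₊

/-- The activation function `K̃(x) = c₀ λ / (λ + 1 / K((x+1)ℓ))`. -/
noncomputable def Ktilde (c₀ lam ρ : ℝ) (ℓ x : ℕ) : ℝ :=
  c₀ * (lam / (lam + 1 / K ρ ((x + 1) * ℓ)))

/-- The position `max {n < j : σ n = 1}` of the rightmost particle strictly to the left of `j`.
For the process below site `0` is always occupied, so for `j ≥ 1` the maximum is over a
non-empty set. -/
def leftParticle (σ : Config) (j : ℕ) : ℕ :=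
  ((Finset.range j).filter (fun n => σ n = true)).sup id

/-- The parameter `K̃(j - h_j(σ))` of the Bernoulli variable attached to site `j`, as an element of
`[0,1]`. The projection onto `[0,1]` is the identity whenever `K̃ ≤ 1`; this is the case for every
`c₀ ≤ 1`, and for every `c₀` as soon as `ℓ` is large. -/
noncomputable def activationProb (c₀ lam ρ : ℝ) (ℓ : ℕ) (σ : Config) (j : ℕ) : unitInterval :=
  Set.projIcc (0 : ℝ) 1 zero_le_one (Ktilde c₀ lam ρ ℓ (j - leftParticle σ j))

/-- The joint law of the variables `(B_j)_j`, given that the current configuration is `σ`: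
independent, and `B_j` is Bernoulli with parameter `K̃(j - h_j(σ))`. (The coordinate `B_0` is not
used.) -/
noncomputable def bernoulliField (c₀ lam ρ : ℝ) (ℓ : ℕ) (σ : Config) : Measure Config :=
  Measure.infinitePi (fun j => bernoulliMeasure true false (activationProb c₀ lam ρ ℓ σ j))

/-- The update `σ_j ↦ σ_j + (1 - σ_j) B_j` for `j ≥ 1`, while site `0` is kept occupied. -/
def update (σ B : Config) : Config :=
  fun j => if j = 0 then true else (σ j || B j)

/-- The law of the next configuration, given that the current one is `σ`. -/
noncomputable def stepLaw (c₀ lam ρ : ℝ) (ℓ : ℕ) (σ : Config) : Measure Config :=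
  (bernoulliField c₀ lam ρ ℓ σ).map (update σ)

theorem measurable_update (σ : Config) : Measurable (update σ) := by
  refine measurable_pi_lambda _ fun j => ?_
  exact (measurable_of_countable (fun b : Bool => if j = 0 then true else (σ j || b))).comp
    (measurable_pi_apply j)

instance (c₀ lam ρ : ℝ) (ℓ : ℕ) (σ : Config) :
    IsProbabilityMeasure (bernoulliField c₀ lam ρ ℓ σ) := by
  unfold bernoulliField; infer_instance

instance (c₀ lam ρ : ℝ) (ℓ : ℕ) (σ : Config) : IsProbabilityMeasure (stepLaw c₀ lam ρ ℓ σ) :=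
  Measure.isProbabilityMeasure_map (measurable_update σ).aemeasurable

theorem measurable_leftParticle (j : ℕ) : Measurable (fun σ : Config => leftParticle σ j) := by
  induction j with
  | zero => exact measurable_const
  | succ j ih =>
    have h : (fun σ : Config => leftParticle σ (j + 1)) =
        fun σ : Config => if σ j = true then max j (leftParticle σ j) else leftParticle σ j := by
      funext σ
      unfold leftParticle
      rw [Finset.range_add_one, Finset.filter_insert]
      split_ifs <;> simp
    rw [h]
    refine Measurable.ite ?_ (measurable_const.max ih) ih
    exact measurableSet_eq_fun (measurable_pi_apply j) measurable_const

theorem stepLaw_pi (c₀ lam ρ : ℝ) (ℓ : ℕ) (σ : Config) (s : Finset ℕ) (t : ℕ → Set Bool) :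
    stepLaw c₀ lam ρ ℓ σ ((s : Set ℕ).pi t) =
      ∏ j ∈ s, bernoulliMeasure true false (activationProb c₀ lam ρ ℓ σ j)
        {b | (if j = 0 then true else (σ j || b)) ∈ t j} := by
  have hpre : update σ ⁻¹' ((s : Set ℕ).pi t) =
      (s : Set ℕ).pi (fun j => {b | (if j = 0 then true else (σ j || b)) ∈ t j}) := rfl
  have hm : MeasurableSet ((s : Set ℕ).pi t) :=
    MeasurableSet.pi s.countable_toSet fun j _ => MeasurableSet.of_discrete
  rw [stepLaw, Measure.map_apply (measurable_update σ) hm, hpre, bernoulliField]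
  exact Measure.infinitePi_pi _ fun j _ => MeasurableSet.of_discrete

theorem measurable_local (g : Bool → ℕ → ENNReal) (j : ℕ) :
    Measurable (fun σ : Config => g (σ j) (leftParticle σ j)) :=
  (measurable_of_countable (Function.uncurry g)).comp
    ((measurable_pi_apply j).prodMk (measurable_leftParticle j))

theorem measurable_bernoulli_factor (c₀ lam ρ : ℝ) (ℓ j : ℕ) (t : Set Bool) :
    Measurable (fun σ : Config => bernoulliMeasure true false (activationProb c₀ lam ρ ℓ σ j)
        {b | (if j = 0 then true else (σ j || b)) ∈ t}) := by
  unfold activationProb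
  exact measurable_local (fun a h => bernoulliMeasure true false
    (Set.projIcc (0 : ℝ) 1 zero_le_one (Ktilde c₀ lam ρ ℓ (j - h)))
      {b | (if j = 0 then true else (a || b)) ∈ t}) j

theorem measurable_stepLaw (c₀ lam ρ : ℝ) (ℓ : ℕ) : Measurable (stepLaw c₀ lam ρ ℓ) := by
  have hgen := (generateFrom_squareCylinders (α := fun _ : ℕ => Bool)).symm
  have hpi := isPiSystem_squareCylinders (α := fun _ : ℕ => Bool)
    (C := fun _ => {s | MeasurableSet s})
    (fun _ => MeasurableSpace.isPiSystem_measurableSet) (fun _ => by simp)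
  refine Measurable.measure_of_isPiSystem_of_isProbabilityMeasure hgen hpi ?_
  rintro _ ⟨s, t, -, rfl⟩
  have h : (fun σ : Config => stepLaw c₀ lam ρ ℓ σ ((s : Set ℕ).pi t)) = fun σ =>
      ∏ j ∈ s, bernoulliMeasure true false (activationProb c₀ lam ρ ℓ σ j)
        {b | (if j = 0 then true else (σ j || b)) ∈ t j} :=
    funext fun σ => stepLaw_pi c₀ lam ρ ℓ σ s t
  rw [h]
  exact Finset.measurable_fun_prod s fun j _ => measurable_bernoulli_factor c₀ lam ρ ℓ j (t j)

/-- The one-step transition kernel of the process. -/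
noncomputable def stepKernel (c₀ lam ρ : ℝ) (ℓ : ℕ) : Kernel Config Config where
  toFun := stepLaw c₀ lam ρ ℓ
  measurable' := measurable_stepLaw c₀ lam ρ ℓ

instance (c₀ lam ρ : ℝ) (ℓ : ℕ) : IsMarkovKernel (stepKernel c₀ lam ρ ℓ) :=
  ⟨fun σ => (inferInstance : IsProbabilityMeasure (stepLaw c₀ lam ρ ℓ σ))⟩

/-- The initial configuration: only site `0` is occupied. -/
def initial : Config := fun j => decide (j = 0)

/-- The law, on trajectories `k ↦ ζ̃(T_k)`, of the Markov chain which starts from `initial` and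
moves according to `stepKernel`. The `k`-th coordinate of a trajectory is the configuration after
`k` updates. -/
noncomputable def processLaw (c₀ lam ρ : ℝ) (ℓ : ℕ) : Measure (ℕ → Config) :=
  Kernel.trajMeasure (X := fun _ : ℕ => Config) (Measure.dirac initial)
    (fun k => (stepKernel c₀ lam ρ ℓ).comap
      (fun x : (Finset.Iic k) → Config => x ⟨k, Finset.mem_Iic.2 le_rfl⟩)
      (measurable_pi_apply _))

end FrontProcess

/-!
Fix a site `j` and follow the distance from `j` to the closest particle on its left, set to `0` once
`j` is occupied; this is `gap j`. It is a Lyapunov function. When the gap is `x`, each of the at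
least `(x + 1) / 2` sites in its right half (with `j` included) is activated with probability at
least `K̃ x`, independently, and a single activation at least halves the gap. Hence one step
multiplies the expected gap by at most `(1 + exp (-q)) / 2 ≤ exp (-q / 4)`, where `q ≤ 1` is a lower
bound for `(x + 1) / 2 * K̃ x` (`lintegral_gap_stepLaw_le`).

The heavy tail of `K` makes `(x + 1) * K̃ x` of order `ℓ⁻¹ ((x + 1) ℓ)^{-ρ}`, which is decreasing
in `x`, so that `q` can be taken of order `ℓ⁻¹ L^{-ρ}` for all gaps below `L / ℓ` (`le_mul_Ktilde`).
As the gap is at most `j` initially and at least `1` while `j` is empty, Markov's inequality bounds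
the probability that `j` is empty after `n` steps by `j * exp (-q n / 4)` (`processLaw_empty_le`).

For `n = ⌊L^ρ ℓ^{2 + ρ + ε}⌋` the product `q n` is of order `ℓ^{1 + ρ + ε}`. It dominates `ℓ` as well
as the `2 log L = O(ℓ)` lost to the initial gap and to the union bound over the sites, so that
the constant `c = 1` works for all values of the parameters.
-/

namespace FrontProcess

/-! ### The gap to the left of a site -/

theorem leftParticle_lt {σ : Config} {j : ℕ} (hj : 1 ≤ j) : leftParticle σ j < j := by
  unfold leftParticle
  rw [Finset.sup_lt_iff (Nat.lt_of_lt_of_le Nat.zero_lt_one hj)]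
  intro n hn
  simpa using (Finset.mem_filter.1 hn).1

theorem le_leftParticle {σ : Config} {i j : ℕ} (hij : i < j) (hi : σ i = true) :
    i ≤ leftParticle σ j :=
  Finset.le_sup (f := id) (Finset.mem_filter.2 ⟨Finset.mem_range.2 hij, hi⟩)

theorem leftParticle_le_leftParticle {σ : Config} {i j : ℕ} (hi : leftParticle σ j < i) :
    leftParticle σ j ≤ leftParticle σ i :=
  Finset.sup_le fun n hn => by
    rw [Finset.mem_filter, Finset.mem_range] at hn
    exact le_leftParticle ((le_leftParticle hn.1 hn.2).trans_lt hi) hn.2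

theorem leftParticle_le_update (σ B : Config) (j : ℕ) :
    leftParticle σ j ≤ leftParticle (update σ B) j := by
  refine Finset.sup_mono fun n hn => ?_
  rw [Finset.mem_filter] at hn ⊢
  refine ⟨hn.1, ?_⟩
  simp [update, hn.2]

/-- The gap at `j`: the distance from `j` to the closest particle strictly to its left while `j` is
empty, and `0` once `j` is occupied. -/
noncomputable def gap (j : ℕ) (σ : Config) : ENNReal :=
  if σ j = true then 0 else ((j - leftParticle σ j : ℕ) : ENNReal)

theorem measurable_gap (j : ℕ) : Measurable (gap j) := by
  unfold gap
  exact measurable_local (fun b h => if b = true then 0 else ((j - h : ℕ) : ENNReal)) j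

theorem gap_le (j : ℕ) (σ : Config) : gap j σ ≤ j := by
  unfold gap
  split_ifs
  · exact zero_le
  · exact_mod_cast Nat.sub_le _ _

theorem one_le_gap {j : ℕ} (hj : 1 ≤ j) {σ : Config} (hσ : ¬ σ j = true) : 1 ≤ gap j σ := by
  have := leftParticle_lt (σ := σ) hj
  rw [gap, if_neg hσ]
  exact_mod_cast (by lia : 1 ≤ j - leftParticle σ j)

theorem gap_update_le (j : ℕ) (σ B : Config) : gap j (update σ B) ≤ gap j σ := by
  unfold gap
  by_cases h : σ j = true
  · simp [update, h]
  · rw [if_neg h]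
    split_ifs
    · exact zero_le
    · have := leftParticle_le_update σ B j
      exact_mod_cast (by lia)

/-- An activation at one of the sites `j - ⌊x/2⌋, …, j`, where `x` is the distance from `j` to the
next particle on its left, at least halves the gap at `j`. -/
theorem gap_update_le_half {j i : ℕ} {σ B : Config} (hj : ¬ σ j = true)
    (hij : i ≤ j) (hi : j - i ≤ (j - leftParticle σ j) / 2) (hB : B i = true) :
    gap j (update σ B) ≤ gap j σ / 2 := by
  have hocc : update σ B i = true := by simp [update, hB]
  rcases hij.eq_or_lt with rfl | hlt
  · simp [gap, hocc]
  · have h1 := le_leftParticle hlt hocc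
    unfold gap
    rw [if_neg hj]
    split_ifs
    · exact zero_le
    · rw [ENNReal.le_div_iff_mul_le (by simp) (by simp)]
      exact_mod_cast (by lia)

/-! ### One step of the chain -/

/-- Nothing is activated in `s` with probability at most `exp (-κ |s|)`, when each site of `s` has
activation function at least `κ`. -/
theorem bernoulliField_all_false_le (c₀ lam ρ : ℝ) (ℓ : ℕ) (σ : Config) (s : Finset ℕ) {κ : ℝ}
    (h : ∀ i ∈ s, κ ≤ Ktilde c₀ lam ρ ℓ (i - leftParticle σ i)) :
    bernoulliField c₀ lam ρ ℓ σ {B | ∀ i ∈ s, B i = false} ≤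
      ENNReal.ofReal (Real.exp (-(s.card * κ))) := by
  have hset : {B : Config | ∀ i ∈ s, B i = false} = (s : Set ℕ).pi (fun _ => {false}) := by
    ext B; simp [Set.mem_pi]
  rw [hset, bernoulliField, Measure.infinitePi_pi _ (fun _ _ => MeasurableSet.of_discrete)]
  have hfac : ∀ i ∈ s, bernoulliMeasure true false (activationProb c₀ lam ρ ℓ σ i) {false} ≤
      ENNReal.ofReal (Real.exp (-κ)) := by
    intro i hi
    -- the projection of `K̃` onto `[0, 1]` is harmless: where it is active, the probability is `0`
    rw [bernoulliMeasure_apply_of_notMem_of_mem _ MeasurableSet.of_discrete (by simp) (by simp),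
      ENNReal.ofReal, ENNReal.coe_le_coe, ← NNReal.coe_le_coe,
      Real.coe_toNNReal _ (Real.exp_pos _).le]
    change 1 - max 0 (min 1 (Ktilde c₀ lam ρ ℓ (i - leftParticle σ i))) ≤ Real.exp (-κ)
    have h1 := Real.add_one_le_exp (-κ)
    have h2 := Real.exp_pos (-κ)
    rcases le_total 1 (Ktilde c₀ lam ρ ℓ (i - leftParticle σ i)) with h3 | h3
    · rw [min_eq_left h3, max_eq_right zero_le_one]
      linarith
    · rw [min_eq_right h3]
      linarith [h i hi, le_max_right 0 (Ktilde c₀ lam ρ ℓ (i - leftParticle σ i))]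
  refine (Finset.prod_le_prod' hfac).trans_eq ?_
  rw [Finset.prod_const, ← ENNReal.ofReal_pow (Real.exp_pos _).le, ← Real.exp_nat_mul]
  ring_nf

/-- The contraction of the gap. If the distance from `j` to the next particle is `x`, each of the
at least `(x + 1) / 2` sites in the right half of the gap is activated at rate at least `K̃ x`, and
one activation there suffices to halve the gap. -/
theorem lintegral_gap_stepLaw_le (c₀ lam ρ : ℝ) (ℓ : ℕ) {j : ℕ} (hj : 1 ≤ j) (σ : Config) {q : ℝ}
    (hnonneg : ∀ x, 0 ≤ Ktilde c₀ lam ρ ℓ x) (hanti : Antitone (Ktilde c₀ lam ρ ℓ))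
    (hrate : ∀ x ≤ j, q ≤ ((x : ℝ) + 1) / 2 * Ktilde c₀ lam ρ ℓ x) :
    ∫⁻ τ, gap j τ ∂(stepLaw c₀ lam ρ ℓ σ) ≤
      ENNReal.ofReal ((1 + Real.exp (-q)) / 2) * gap j σ := by
  rw [stepLaw, lintegral_map (measurable_gap j) (measurable_update σ)]
  by_cases hσ : σ j = true
  · have : ∀ B, gap j (update σ B) = 0 := fun B => by simp [gap, update, hσ]
    simp [this]
  set h := leftParticle σ j
  have hlt : h < j := leftParticle_lt hj
  set x := j - h with hx
  set s := Finset.Icc (j - x / 2) j with hs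
  set E : Set Config := {B | ∀ i ∈ s, B i = false} with hE
  have hEm : MeasurableSet E := by
    have : E = (s : Set ℕ).pi (fun _ => {false}) := by
      ext B; simp [hE, Set.mem_pi]
    rw [this]
    exact MeasurableSet.pi s.countable_toSet fun _ _ => MeasurableSet.of_discrete
  have hpt : ∀ B, gap j (update σ B) ≤ gap j σ / 2 + E.indicator (fun _ => gap j σ / 2) B := by
    intro B
    by_cases hB : B ∈ E
    · rw [Set.indicator_of_mem hB, ENNReal.add_halves]
      exact gap_update_le j σ B
    · rw [Set.indicator_of_notMem hB, add_zero]
      simp only [hE, Set.mem_ofPred_eq, not_forall, Bool.not_eq_false] at hB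
      obtain ⟨i, hi, hBi⟩ := hB
      rw [hs, Finset.mem_Icc] at hi
      exact gap_update_le_half hσ hi.2 (by lia) hBi
  have hprob : bernoulliField c₀ lam ρ ℓ σ E ≤ ENNReal.ofReal (Real.exp (-q)) := by
    refine (bernoulliField_all_false_le c₀ lam ρ ℓ σ s
      (κ := Ktilde c₀ lam ρ ℓ x) ?_).trans ?_
    · intro i hi
      rw [hs, Finset.mem_Icc] at hi
      have hi1 : 1 ≤ i := by lia
      have hle : leftParticle σ i < i := leftParticle_lt hi1
      have hge : h ≤ leftParticle σ i := leftParticle_le_leftParticle (by lia)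
      exact hanti (by lia)
    · refine ENNReal.ofReal_le_ofReal (Real.exp_le_exp.2
        (neg_le_neg ((hrate x (Nat.sub_le _ _)).trans ?_)))
      refine mul_le_mul_of_nonneg_right ?_ (hnonneg x)
      rw [hs, Nat.card_Icc, div_le_iff₀ two_pos]
      exact_mod_cast (by lia)
  calc ∫⁻ B, gap j (update σ B) ∂(bernoulliField c₀ lam ρ ℓ σ)
      ≤ ∫⁻ B, (gap j σ / 2 + E.indicator (fun _ => gap j σ / 2) B)
          ∂(bernoulliField c₀ lam ρ ℓ σ) := lintegral_mono hpt
    _ = gap j σ / 2 + gap j σ / 2 * bernoulliField c₀ lam ρ ℓ σ E := by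
        rw [lintegral_add_left measurable_const, lintegral_indicator_const hEm]
        simp
    _ ≤ gap j σ / 2 + gap j σ / 2 * ENNReal.ofReal (Real.exp (-q)) := by gcongr
    _ = ENNReal.ofReal ((1 + Real.exp (-q)) / 2) * gap j σ := by
        rw [ENNReal.ofReal_div_of_pos two_pos, ENNReal.ofReal_add zero_le_one (Real.exp_pos _).le]
        simp only [ENNReal.ofReal_one, ENNReal.ofReal_ofNat, div_eq_mul_inv]
        ring

/-! ### Iterating along the trajectory -/

/-- The Markov property of the trajectory measure, for a function of one coordinate. -/
theorem lintegral_processLaw_succ (c₀ lam ρ : ℝ) (ℓ k : ℕ) {f : Config → ENNReal}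
    (hf : Measurable f) :
    ∫⁻ ζ, f (ζ (k + 1)) ∂(processLaw c₀ lam ρ ℓ) =
      ∫⁻ ζ, ∫⁻ τ, f τ ∂(stepLaw c₀ lam ρ ℓ (ζ k)) ∂(processLaw c₀ lam ρ ℓ) := by
  have key := Kernel.map_frestrictLe_trajMeasure_compProd_eq_map_trajMeasure
    (X := fun _ : ℕ => Config) (μ₀ := Measure.dirac initial)
    (κ := fun k => (stepKernel c₀ lam ρ ℓ).comap
      (fun x : (Finset.Iic k) → Config => x ⟨k, Finset.mem_Iic.2 le_rfl⟩)
      (measurable_pi_apply _)) (a := k)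
  have hin : Measurable fun x : (Finset.Iic k) → Config =>
      ∫⁻ τ, f τ ∂(stepKernel c₀ lam ρ ℓ (x ⟨k, Finset.mem_Iic.2 le_rfl⟩)) :=
    hf.lintegral_kernel.comp (measurable_pi_apply _)
  have hpair : Measurable fun ζ : ℕ → Config =>
      (Preorder.frestrictLe (π := fun _ : ℕ => Config) k ζ, ζ (k + 1)) := by fun_prop
  calc ∫⁻ ζ, f (ζ (k + 1)) ∂(processLaw c₀ lam ρ ℓ)
      = ∫⁻ z, f z.2 ∂((processLaw c₀ lam ρ ℓ).map
          fun ζ => (Preorder.frestrictLe (π := fun _ : ℕ => Config) k ζ, ζ (k + 1))) :=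
        (lintegral_map (hf.comp measurable_snd) hpair).symm
    _ = _ := by
        rw [processLaw, ← key, Measure.lintegral_compProd (f := fun z => f z.2)
          (hf.comp measurable_snd)]
        exact lintegral_map hin (by fun_prop)

instance (c₀ lam ρ : ℝ) (ℓ : ℕ) : IsProbabilityMeasure (processLaw c₀ lam ρ ℓ) := by
  unfold processLaw; infer_instance

/-- Markov's inequality for the gap: it is at most `j` at time `0`, and at least `1` as long as
`j` is empty. -/
theorem processLaw_empty_le (c₀ lam ρ : ℝ) (ℓ n : ℕ) {j : ℕ} (hj : 1 ≤ j) {θ : ENNReal}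
    (hθ : ∀ σ, ∫⁻ τ, gap j τ ∂(stepLaw c₀ lam ρ ℓ σ) ≤ θ * gap j σ) :
    processLaw c₀ lam ρ ℓ {ζ | ¬ ζ n j = true} ≤ θ ^ n * j := by
  have hgap : ∀ k, Measurable fun ζ : ℕ → Config => gap j (ζ k) := fun k =>
    (measurable_gap j).comp (measurable_pi_apply k)
  have hE : ∀ n, ∫⁻ ζ, gap j (ζ n) ∂(processLaw c₀ lam ρ ℓ) ≤ θ ^ n * j := by
    intro n
    induction n with
    | zero =>
      calc ∫⁻ ζ, gap j (ζ 0) ∂(processLaw c₀ lam ρ ℓ)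
          ≤ ∫⁻ _, (j : ENNReal) ∂(processLaw c₀ lam ρ ℓ) := lintegral_mono fun ζ => gap_le j (ζ 0)
        _ = θ ^ 0 * j := by simp
    | succ k ih =>
      rw [lintegral_processLaw_succ _ _ _ _ _ (measurable_gap j)]
      calc ∫⁻ ζ, ∫⁻ τ, gap j τ ∂(stepLaw c₀ lam ρ ℓ (ζ k)) ∂(processLaw c₀ lam ρ ℓ)
          ≤ ∫⁻ ζ, θ * gap j (ζ k) ∂(processLaw c₀ lam ρ ℓ) := lintegral_mono fun ζ => hθ (ζ k)
        _ = θ * ∫⁻ ζ, gap j (ζ k) ∂(processLaw c₀ lam ρ ℓ) := lintegral_const_mul _ (hgap k)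
        _ ≤ θ * (θ ^ k * j) := by gcongr
        _ = θ ^ (k + 1) * j := by ring
  calc processLaw c₀ lam ρ ℓ {ζ | ¬ ζ n j = true}
      ≤ processLaw c₀ lam ρ ℓ {ζ | 1 ≤ gap j (ζ n)} :=
        measure_mono fun ζ hζ => one_le_gap hj hζ
    _ ≤ ∫⁻ ζ, gap j (ζ n) ∂(processLaw c₀ lam ρ ℓ) := by
        simpa using mul_meas_ge_le_lintegral (hgap n) 1
    _ ≤ θ ^ n * j := hE n

theorem one_sub_le_processLaw_filled (c₀ lam ρ : ℝ) (ℓ n r : ℕ) {p : ℝ}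
    (hp : ∀ j ∈ Finset.Icc 1 r, (processLaw c₀ lam ρ ℓ).real {ζ | ¬ ζ n j = true} ≤ p) :
    1 - r * p ≤ (processLaw c₀ lam ρ ℓ).real
      {ζ | ∀ j : ℕ, 1 ≤ j → j ≤ r → ζ n j = true} := by
  set G := {ζ : ℕ → Config | ∀ j : ℕ, 1 ≤ j → j ≤ r → ζ n j = true} with hG
  have hGm : MeasurableSet G := by
    simp only [hG, Set.ofPred_forall]
    refine MeasurableSet.iInter fun j => MeasurableSet.iInter fun _ => MeasurableSet.iInter fun _ =>
      measurableSet_eq_fun ?_ measurable_const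
    fun_prop
  have hsub : Gᶜ ⊆ ⋃ j ∈ Finset.Icc 1 r, {ζ : ℕ → Config | ¬ ζ n j = true} := by
    intro ζ hζ
    simp only [hG, Set.mem_compl_iff, Set.mem_ofPred_eq, not_forall] at hζ
    obtain ⟨j, h1, h2, h3⟩ := hζ
    exact Set.mem_biUnion (Finset.mem_coe.2 (Finset.mem_Icc.2 ⟨h1, h2⟩)) h3
  have hGc : (processLaw c₀ lam ρ ℓ).real Gᶜ ≤ r * p :=
    calc (processLaw c₀ lam ρ ℓ).real Gᶜ
        ≤ (processLaw c₀ lam ρ ℓ).real (⋃ j ∈ Finset.Icc 1 r, {ζ : ℕ → Config | ¬ ζ n j = true}) :=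
          measureReal_mono hsub (measure_ne_top _ _)
      _ ≤ ∑ j ∈ Finset.Icc 1 r, (processLaw c₀ lam ρ ℓ).real {ζ : ℕ → Config | ¬ ζ n j = true} :=
          measureReal_biUnion_finset_le _ _
      _ ≤ ∑ _j ∈ Finset.Icc 1 r, p := Finset.sum_le_sum hp
      _ = r * p := by simp
  rw [probReal_compl_eq_one_sub hGm] at hGc
  linarith

/-! ### The activation function -/

theorem normalization_pos {ρ : ℝ} (hρ : 0 < ρ) :
    0 < (∑' i : ℕ, ((i : ℝ) + 1) ^ (-(1 + ρ)))⁻¹ := by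
  have hs : Summable fun i : ℕ => ((i : ℝ) + 1) ^ (-(1 + ρ)) := by
    have := (summable_nat_add_iff 1).2 (Real.summable_nat_rpow.2 (by linarith : -(1 + ρ) < -1))
    simpa using this
  exact inv_pos.2 (hs.tsum_pos (fun i => by positivity) 0 (by norm_num))

/-- `K̃` with the normalizing constant moved into the denominator, which makes its monotonicity
and positivity visible. -/
theorem Ktilde_eq {c₀ lam ρ : ℝ} (ℓ x : ℕ) :
    Ktilde c₀ lam ρ ℓ x = c₀ * (lam / (lam + (∑' i : ℕ, ((i : ℝ) + 1) ^ (-(1 + ρ))) *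
      (((x : ℝ) + 1) * ℓ) ^ (1 + ρ))) := by
  rw [Ktilde, K, one_div, mul_inv, inv_inv]
  push_cast
  rw [Real.rpow_neg (by positivity), inv_inv]

theorem Ktilde_nonneg {c₀ lam ρ : ℝ} (hc₀ : 0 < c₀) (hlam : 0 < lam) (hρ : 0 < ρ) (ℓ x : ℕ) :
    0 ≤ Ktilde c₀ lam ρ ℓ x := by
  have := inv_pos.1 (normalization_pos hρ)
  rw [Ktilde_eq]
  positivity

theorem Ktilde_antitone {c₀ lam ρ : ℝ} (hc₀ : 0 < c₀) (hlam : 0 < lam) (hρ : 0 < ρ) (ℓ : ℕ) :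
    Antitone (Ktilde c₀ lam ρ ℓ) := by
  intro x y hxy
  have := inv_pos.1 (normalization_pos hρ)
  rw [Ktilde_eq, Ktilde_eq]
  gcongr

/-- The activation rate of the right half of a gap of size `x` is at least of order
`ℓ⁻¹ ((x + 1) ℓ)^{-ρ}`, hence of order `ℓ⁻¹ L^{-ρ}` when `(x + 1) ℓ ≤ L`. -/
theorem le_mul_Ktilde {c₀ lam ρ : ℝ} (hc₀ : 0 < c₀) (hlam : 0 < lam) (hρ : 0 < ρ) {ℓ x L : ℕ}
    (hℓ : 1 ≤ ℓ) (hL : (x + 1) * ℓ ≤ L) :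
    c₀ * lam / (lam + ∑' i : ℕ, ((i : ℝ) + 1) ^ (-(1 + ρ))) / (2 * (L : ℝ) ^ ρ * ℓ) ≤
      ((x : ℝ) + 1) / 2 * Ktilde c₀ lam ρ ℓ x := by
  have hS := inv_pos.1 (normalization_pos hρ)
  rw [Ktilde_eq]
  set S := ∑' i : ℕ, ((i : ℝ) + 1) ^ (-(1 + ρ))
  have hℓ' : (1 : ℝ) ≤ ℓ := by exact_mod_cast hℓ
  have hx : (0 : ℝ) ≤ x := Nat.cast_nonneg x
  set y : ℝ := ((x : ℝ) + 1) * ℓ with hy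
  have hy1 : 1 ≤ y := by nlinarith
  have hyL : y ≤ L := by rw [hy]; exact_mod_cast hL
  have hypow : 1 ≤ y ^ (1 + ρ) := Real.one_le_rpow hy1 (by linarith)
  have hden : lam + S * y ^ (1 + ρ) ≤ (lam + S) * (y * (L : ℝ) ^ ρ) := by
    calc lam + S * y ^ (1 + ρ) ≤ (lam + S) * y ^ (1 + ρ) := by nlinarith
      _ = (lam + S) * (y * y ^ ρ) := by rw [Real.rpow_add (by linarith), Real.rpow_one]
      _ ≤ _ := by gcongr
  have hLpos : (0 : ℝ) < (L : ℝ) ^ ρ := Real.rpow_pos_of_pos (by linarith) _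
  calc c₀ * lam / (lam + S) / (2 * (L : ℝ) ^ ρ * ℓ)
      = ((x : ℝ) + 1) / 2 * (c₀ * (lam / ((lam + S) * (y * (L : ℝ) ^ ρ)))) := by
        rw [hy]; field_simp
    _ ≤ _ := by gcongr

/-! ### Asymptotics of the scales -/

theorem tendsto_blockLength {β : ℝ} (hβ : 0 < β) :
    Filter.Tendsto (blockLength β) Filter.atTop Filter.atTop :=
  tendsto_nat_floor_atTop.comp ((tendsto_rpow_atTop (by linarith)).comp
    (Real.tendsto_log_atTop.comp tendsto_natCast_atTop_atTop))

/-- Since `ℓ` grows at least like `log L`, a factor polynomial in `L` costs only `exp (O(ℓ))`. -/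
theorem log_le_blockLength_add_one {β : ℝ} (hβ : 0 < β) {L : ℕ} (hL : 1 ≤ Real.log L) :
    Real.log L ≤ blockLength β L + 1 :=
  calc Real.log L = Real.log L ^ (1 : ℝ) := (Real.rpow_one _).symm
    _ ≤ Real.log L ^ (1 + β) := Real.rpow_le_rpow_of_exponent_le hL (by linarith)
    _ ≤ blockLength β L + 1 := (Nat.lt_floor_add_one _).le

theorem one_add_exp_neg_div_two_le {q : ℝ} (h0 : 0 ≤ q) (h1 : q ≤ 1) :
    (1 + Real.exp (-q)) / 2 ≤ Real.exp (-(q / 4)) := by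
  have h2 : Real.exp (-q) ≤ 1 - q / 2 := by
    rw [Real.exp_neg, inv_le_iff_one_le_mul₀ (Real.exp_pos q)]
    nlinarith [Real.add_one_le_exp q]
  linarith [Real.add_one_le_exp (-(q / 4))]

end FrontProcess

open FrontProcess in
theorem theorem5p9 (lam ε : ℝ) (hlam : 0 < lam) (hε : 0 < ε) :
    ∃ c : ℝ, 0 < c ∧
      ∀ ρ β c₀ : ℝ, 0 < ρ → ρ < 1 → 0 < β → 0 < c₀ →
        ∃ L₀ : ℕ, ∀ L : ℕ, L₀ ≤ L →
          1 - Real.exp (-c * (FrontProcess.blockLength β L : ℝ)) ≤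
            (FrontProcess.processLaw c₀ lam ρ (FrontProcess.blockLength β L)).real
              {ζ | ∀ j : ℕ, 1 ≤ j → j ≤ L / FrontProcess.blockLength β L - 1 →
                ζ ⌊(L : ℝ) ^ ρ * (FrontProcess.blockLength β L : ℝ) ^ (2 + ρ + ε)⌋₊ j = true} := by
  refine ⟨1, one_pos, fun ρ β c₀ hρ _ hβ hc₀ => ?_⟩
  have hS := inv_pos.1 (normalization_pos hρ)
  -- the minimum with `1` guarantees `q ≤ 1` below
  set a : ℝ := min 1 (c₀ * lam / (lam + ∑' i : ℕ, ((i : ℝ) + 1) ^ (-(1 + ρ))))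
  have ha0 : 0 < a := lt_min one_pos (by positivity)
  -- up to rounding, the number of steps times the rate `q` below is `a / 2 * ℓ ^ (1 + ρ + ε)`, which
  -- has to exceed `4 (ℓ + 2 log L)`; for this `48 / a ≤ ℓ ^ (ρ + ε)` is enough
  have hpow : ∀ᶠ L : ℕ in Filter.atTop, 48 / a ≤ (blockLength β L : ℝ) ^ (ρ + ε) :=
    ((tendsto_rpow_atTop (by linarith)).comp
      (tendsto_natCast_atTop_atTop.comp (tendsto_blockLength hβ))).eventually_ge_atTop _
  have hlog : ∀ᶠ L : ℕ in Filter.atTop, 1 ≤ Real.log L :=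
    (Real.tendsto_log_atTop.comp tendsto_natCast_atTop_atTop).eventually_ge_atTop _
  obtain ⟨L₀, hL₀⟩ := Filter.eventually_atTop.1
    (hpow.and (hlog.and ((tendsto_blockLength hβ).eventually_ge_atTop 1)))
  refine ⟨L₀, fun L hL => ?_⟩
  obtain ⟨hpow, hlog, hℓ⟩ := hL₀ L hL
  have hloglen := log_le_blockLength_add_one hβ hlog
  generalize blockLength β L = ℓ at *
  have hℓ' : (1 : ℝ) ≤ ℓ := by exact_mod_cast hℓ
  have hL1 : (1 : ℝ) ≤ L := by
    by_contra! h
    have : L = 0 := by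
      have : L < 1 := by exact_mod_cast h
      lia
    subst this
    norm_num at hlog
  have hLρ : 1 ≤ (L : ℝ) ^ ρ := Real.one_le_rpow hL1 hρ.le
  set n := ⌊(L : ℝ) ^ ρ * (ℓ : ℝ) ^ (2 + ρ + ε)⌋₊
  set r := L / ℓ - 1 with hr
  set q : ℝ := a / (2 * (L : ℝ) ^ ρ * ℓ) with hq
  have hq0 : 0 ≤ q := by positivity
  have hq1 : q ≤ 1 := by
    rw [hq, div_le_one (by positivity)]
    nlinarith [min_le_left 1 (c₀ * lam / (lam + ∑' i : ℕ, ((i : ℝ) + 1) ^ (-(1 + ρ))))]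
  have hqn : ℓ + 2 * Real.log L ≤ q / 4 * n := by
    have h1 : (L : ℝ) ^ ρ * (ℓ : ℝ) ^ (2 + ρ + ε) - 1 ≤ n := (Nat.sub_one_lt_floor _).le
    have h2 : q * ((L : ℝ) ^ ρ * (ℓ : ℝ) ^ (2 + ρ + ε)) = a / 2 * (ℓ * (ℓ : ℝ) ^ (ρ + ε)) := by
      rw [show 2 + ρ + ε = 1 + 1 + (ρ + ε) by ring, Real.rpow_add (by linarith),
        Real.rpow_add (by linarith), Real.rpow_one, hq]
      field_simp
    have h3 : 24 * (ℓ : ℝ) ≤ a / 2 * (ℓ * (ℓ : ℝ) ^ (ρ + ε)) := by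
      rw [div_le_iff₀ ha0] at hpow
      nlinarith
    nlinarith
  have hrL : (r : ℝ) ≤ L := by exact_mod_cast (Nat.sub_le _ _).trans (Nat.div_le_self _ _)
  have hsite : ∀ j ∈ Finset.Icc 1 r, (processLaw c₀ lam ρ ℓ).real {ζ | ¬ ζ n j = true} ≤
      Real.exp (-(q / 4 * n)) * L := by
    intro j hj
    rw [Finset.mem_Icc] at hj
    have hrate : ∀ x ≤ j, q ≤ ((x : ℝ) + 1) / 2 * Ktilde c₀ lam ρ ℓ x := by
      intro x hxj
      have hxL : (x + 1) * ℓ ≤ L :=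
        (Nat.mul_le_mul_right ℓ (by lia : x + 1 ≤ L / ℓ)).trans (Nat.div_mul_le_self L ℓ)
      refine le_trans ?_ (le_mul_Ktilde hc₀ hlam hρ hℓ hxL)
      rw [hq]
      gcongr
      exact min_le_right _ _
    have hcontr := fun σ => lintegral_gap_stepLaw_le c₀ lam ρ ℓ hj.1 σ
      (Ktilde_nonneg hc₀ hlam hρ ℓ) (Ktilde_antitone hc₀ hlam hρ ℓ) hrate
    have hE : 0 ≤ (1 + Real.exp (-q)) / 2 := by positivity
    refine (ENNReal.toReal_mono (by finiteness)
      (processLaw_empty_le c₀ lam ρ ℓ n hj.1 hcontr)).trans ?_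
    rw [ENNReal.toReal_mul, ENNReal.toReal_pow, ENNReal.toReal_ofReal hE, ENNReal.toReal_natCast]
    have hjL : (j : ℝ) ≤ L := le_trans (by exact_mod_cast hj.2) hrL
    have hexp : Real.exp (-(q / 4 * n)) = Real.exp (-(q / 4)) ^ n := by
      rw [← Real.exp_nat_mul]; ring_nf
    rw [hexp]
    gcongr
    exact one_add_exp_neg_div_two_le hq0 hq1
  refine le_trans ?_ (one_sub_le_processLaw_filled c₀ lam ρ ℓ n r hsite)
  refine sub_le_sub_left ?_ 1
  calc (r : ℝ) * (Real.exp (-(q / 4 * n)) * L)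
      ≤ L * (Real.exp (-(q / 4 * n)) * L) := by gcongr
    _ = Real.exp (-(q / 4 * n) + 2 * Real.log L) := by
        rw [Real.exp_add, two_mul, Real.exp_add, Real.exp_log (by linarith)]; ring
    _ ≤ Real.exp (-1 * ℓ) := Real.exp_le_exp.2 (by linarith)
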